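/- Let $n\ge 0$ be an integer and let $\mathbb{K}$ be a field. Let $A_s(n,\mathbb{K})$ be the $\mathbb{K}$-algebra presented by generators $u_{ij}$, $1\le i,j\le n$, subject to the relations making $u=(u_{ij})$ a magic matrix: $$u_{ki}u_{kj}=\delta_{ij}u_{ki},\qquad u_{ik}u_{jk}=\delta_{ij}u_{ik},\qquad \sum_{k=1}^n u_{ik}=1=\sum_{k=1}^n u_{ki}\qquad (1\le i,j,k\le n),$$ endowed with its Hopf algebra structure given by $$\Delta(u_{ij})=\sum_{k=1}^n u_{ik}\otimes u_{kj},\qquad \varepsilon(u_{ij})=\delta_{ij},\qquad S(u_{ij})=u_{ji}.$$ A Hopf algebra is called cosemisimple if its category of (right) comodules is semisimple, that is, every subcomodule of every comodule, of arbitrary dimension, has a complementary subcomodule. A Hopf $*$-algebra is a complex Hopf algebra with a conjugate-linear, antimultiplicative involution $*$ such that $\Delta$ and $\varepsilon$ are $*$-maps. It is called a CQG algebra if each of its finite-dimensional comodules $V$, with coaction $\rho$, is equivalent to a unitary one, that is, $V$ has a basis $(b_i)$ such that the matrix $x=(x_{ij})$ defined by $\rho(b_j)=\sum_i b_i\otimes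 x_{ij}$ is unitary: $x^*x=xx^*=1$, where $(x^*)_{ij}=x_{ji}^*$. 1. If $\mathbb{K}$ has characteristic zero, then the Hopf algebra $A_s(n,\mathbb{K})$ is cosemisimple. 2. If $\mathbb{K}=\mathbb{C}$, then $A_s(n,\mathbb{C})$ has a Hopf $*$-algebra structure given by $u_{ij}^*=u_{ij}$ for all $i,j$, and with this structure it is a CQG algebra. -/

import Mathlib

open scoped TensorProduct

universe u v w

/-- The defining relations between the generators `x i j` of the free algebra: they say that
`x` is a magic matrix. -/
inductive MagicRel (n : ℕ) (K : Type u) [Field K] :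
    FreeAlgebra K (Fin n × Fin n) → FreeAlgebra K (Fin n × Fin n) → Prop
  | row_mul (i j k : Fin n) : MagicRel n K
      (FreeAlgebra.ι K (k, i) * FreeAlgebra.ι K (k, j))
      (if i = j then FreeAlgebra.ι K (k, i) else 0)
  | row_sum (i : Fin n) : MagicRel n K (∑ k, FreeAlgebra.ι K (i, k)) 1
  | col_mul (i j k : Fin n) : MagicRel n K
      (FreeAlgebra.ι K (i, k) * FreeAlgebra.ι K (j, k))
      (if i = j then FreeAlgebra.ι K (i, k) else 0)
  | col_sum (i : Fin n) : MagicRel n K (∑ k, FreeAlgebra.ι K (k, i)) 1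

/-- The algebra `A_s(n, K)` presented by generators `u i j` subject to the relations making
`(u i j)` a magic matrix. -/
def QPermAlg (n : ℕ) (K : Type u) [Field K] : Type u := RingQuot (MagicRel n K)

namespace QPermAlg

noncomputable section

variable {n : ℕ} {K : Type u} [Field K]

instance : Ring (QPermAlg n K) := inferInstanceAs (Ring (RingQuot (MagicRel n K)))

instance : Algebra K (QPermAlg n K) := inferInstanceAs (Algebra K (RingQuot (MagicRel n K)))

/-- The canonical projection from the free algebra. -/
def mk : FreeAlgebra K (Fin n × Fin n) →ₐ[K] QPermAlg n K :=
  RingQuot.mkAlgHom K (MagicRel n K)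

/-- The generators `u i j` of `A_s(n, K)`. -/
def u (i j : Fin n) : QPermAlg n K := mk (FreeAlgebra.ι K (i, j))

theorem mk_rel {x y : FreeAlgebra K (Fin n × Fin n)} (h : MagicRel n K x y) :
    (mk x : QPermAlg n K) = mk y := RingQuot.mkAlgHom_rel K h

theorem row_mul (i j k : Fin n) :
    (u k i * u k j : QPermAlg n K) = if i = j then u k i else 0 := by
  have h := mk_rel (MagicRel.row_mul (K := K) i j k)
  rw [map_mul] at h
  refine h.trans ?_
  split_ifs
  · rfl
  · exact map_zero _

theorem col_mul (i j k : Fin n) :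
    (u i k * u j k : QPermAlg n K) = if i = j then u i k else 0 := by
  have h := mk_rel (MagicRel.col_mul (K := K) i j k)
  rw [map_mul] at h
  refine h.trans ?_
  split_ifs
  · rfl
  · exact map_zero _

theorem row_sum (i : Fin n) : ∑ k, (u i k : QPermAlg n K) = 1 := by
  have h := mk_rel (MagicRel.row_sum (K := K) i)
  rwa [map_sum, map_one] at h

theorem col_sum (i : Fin n) : ∑ k, (u k i : QPermAlg n K) = 1 := by
  have h := mk_rel (MagicRel.col_sum (K := K) i)
  rwa [map_sum, map_one] at h

/-- A matrix over an algebra is magic if its entries satisfy the four families of relations. -/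
structure IsMagic {B : Type v} [Ring B] (x : Fin n → Fin n → B) : Prop where
  row_mul : ∀ i j k, x k i * x k j = if i = j then x k i else 0
  row_sum : ∀ i, ∑ k, x i k = 1
  col_mul : ∀ i j k, x i k * x j k = if i = j then x i k else 0
  col_sum : ∀ i, ∑ k, x k i = 1

/-- The universal property of the presentation. -/
def lift {B : Type v} [Ring B] [Algebra K B] (x : Fin n → Fin n → B) (hx : IsMagic x) :
    QPermAlg n K →ₐ[K] B :=
  RingQuot.liftAlgHom K ⟨FreeAlgebra.lift K (fun p : Fin n × Fin n => x p.1 p.2), by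
    intro a b h
    cases h with
    | row_mul i j k =>
      simp only [map_mul, FreeAlgebra.lift_ι_apply, hx.row_mul]
      split_ifs <;> simp
    | row_sum i => simp [hx.row_sum]
    | col_mul i j k =>
      simp only [map_mul, FreeAlgebra.lift_ι_apply, hx.col_mul]
      split_ifs <;> simp
    | col_sum i => simp [hx.col_sum]⟩

@[simp]
theorem lift_u {B : Type v} [Ring B] [Algebra K B] (x : Fin n → Fin n → B) (hx : IsMagic x)
    (i j : Fin n) : lift (K := K) x hx (u i j) = x i j := by
  unfold lift u mk
  erw [RingQuot.liftAlgHom_mkAlgHom_apply]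
  simp

theorem algHom_ext {B : Type v} [Ring B] [Algebra K B] {f g : QPermAlg n K →ₐ[K] B}
    (h : ∀ i j, f (u i j) = g (u i j)) : f = g := by
  apply RingQuot.ringQuot_ext'
  apply FreeAlgebra.hom_ext
  funext p
  exact h p.1 p.2

theorem induction {P : QPermAlg n K → Prop} (hK : ∀ r : K, P (algebraMap K _ r))
    (hu : ∀ i j, P (u i j)) (hmul : ∀ a b, P a → P b → P (a * b))
    (hadd : ∀ a b, P a → P b → P (a + b)) (a : QPermAlg n K) : P a := by
  obtain ⟨x, rfl⟩ : ∃ x, mk x = a := RingQuot.mkAlgHom_surjective K (MagicRel n K) a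
  induction x using FreeAlgebra.induction with
  | grade0 r => rw [AlgHom.commutes]; exact hK r
  | grade1 p => exact hu p.1 p.2
  | mul a b ha hb => rw [map_mul]; exact hmul _ _ ha hb
  | add a b ha hb => rw [map_add]; exact hadd _ _ ha hb

theorem isMagic_comul : IsMagic
    (fun i j => ∑ k, (u i k : QPermAlg n K) ⊗ₜ[K] (u k j : QPermAlg n K)) where
  row_mul i j k := by
    simp only [Finset.sum_mul_sum, Algebra.TensorProduct.tmul_mul_tmul, row_mul]
    simp only [TensorProduct.ite_tmul, TensorProduct.tmul_ite, row_mul,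
      Finset.sum_ite_eq, Finset.mem_univ, if_true]
    split_ifs <;> simp
  row_sum i := by
    rw [Finset.sum_comm]
    simp only [← TensorProduct.tmul_sum, row_sum]
    rw [← TensorProduct.sum_tmul, row_sum, Algebra.TensorProduct.one_def]
  col_mul i j k := by
    simp only [Finset.sum_mul_sum, Algebra.TensorProduct.tmul_mul_tmul, col_mul]
    simp only [TensorProduct.ite_tmul, TensorProduct.tmul_ite, col_mul,
      Finset.sum_ite_eq, Finset.mem_univ, if_true]
    split_ifs <;> simp
  col_sum i := by
    rw [Finset.sum_comm]
    simp only [← TensorProduct.sum_tmul, col_sum]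
    rw [← TensorProduct.tmul_sum, col_sum, Algebra.TensorProduct.one_def]

theorem isMagic_counit : IsMagic (fun i j : Fin n => if i = j then (1 : K) else 0) where
  row_mul i j k := by grind
  row_sum i := by simp
  col_mul i j k := by grind
  col_sum i := by simp

theorem isMagic_antipode :
    IsMagic (fun i j : Fin n => MulOpposite.op (u j i : QPermAlg n K)) where
  row_mul i j k := by
    rw [← MulOpposite.op_mul, col_mul]
    grind [MulOpposite.op_zero]
  row_sum i := by rw [← Finset.op_sum, col_sum, MulOpposite.op_one]
  col_mul i j k := by
    rw [← MulOpposite.op_mul, row_mul]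
    grind [MulOpposite.op_zero]
  col_sum i := by rw [← Finset.op_sum, row_sum, MulOpposite.op_one]

variable (n K)

/-- The comultiplication, `Δ(u i j) = ∑ k, u i k ⊗ u k j`. -/
def comulHom : QPermAlg n K →ₐ[K] QPermAlg n K ⊗[K] QPermAlg n K := lift _ isMagic_comul

/-- The counit, `ε(u i j) = δ i j`. -/
def counitHom : QPermAlg n K →ₐ[K] K := lift _ isMagic_counit

/-- The antipode as an algebra map to the opposite algebra, `S(u i j) = u j i`. -/
def antipodeHom : QPermAlg n K →ₐ[K] (QPermAlg n K)ᵐᵒᵖ := lift _ isMagic_antipode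

/-- The antipode as a linear map. -/
def antipodeLin : QPermAlg n K →ₗ[K] QPermAlg n K :=
  (MulOpposite.opLinearEquiv K).symm.toLinearMap ∘ₗ (antipodeHom n K).toLinearMap

variable {n K}

@[simp]
theorem comulHom_u (i j : Fin n) : comulHom n K (u i j) = ∑ k, u i k ⊗ₜ[K] u k j :=
  lift_u _ _ i j

@[simp]
theorem counitHom_u (i j : Fin n) : counitHom n K (u i j) = if i = j then 1 else 0 :=
  lift_u _ _ i j

@[simp]
theorem antipodeLin_u (i j : Fin n) : antipodeLin n K (u i j) = u j i := by
  simp [antipodeLin, antipodeHom]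

theorem antipodeLin_mul (a b : QPermAlg n K) :
    antipodeLin n K (a * b) = antipodeLin n K b * antipodeLin n K a := by
  simp [antipodeLin]

theorem antipodeLin_algebraMap (r : K) :
    antipodeLin n K (algebraMap K _ r) = algebraMap K _ r := by
  simp [antipodeLin]

instance : Bialgebra K (QPermAlg n K) :=
  Bialgebra.ofAlgHom (comulHom n K) (counitHom n K)
    (by
      apply algHom_ext
      intro i j
      simp only [AlgHom.comp_apply, comulHom_u, map_sum, Algebra.TensorProduct.map_tmul,
        TensorProduct.sum_tmul, TensorProduct.tmul_sum, AlgHom.id_apply]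
      rw [Finset.sum_comm]
      simp)
    (by
      apply algHom_ext
      intro i j
      simp [TensorProduct.ite_tmul])
    (by
      apply algHom_ext
      intro i j
      simp [TensorProduct.tmul_ite])

theorem comul_eq (a : QPermAlg n K) : Coalgebra.comul (R := K) a = comulHom n K a := rfl

theorem counit_eq (a : QPermAlg n K) : Coalgebra.counit (R := K) a = counitHom n K a := rfl

theorem mul_rTensor_aux (x : QPermAlg n K ⊗[K] QPermAlg n K) (p q : QPermAlg n K) :
    LinearMap.mul' K _ ((antipodeLin n K).rTensor _ (x * p ⊗ₜ q)) =
      antipodeLin n K p * LinearMap.mul' K _ ((antipodeLin n K).rTensor _ x) * q := by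
  induction x using TensorProduct.induction_on with
  | zero => simp
  | tmul a b => simp [antipodeLin_mul, mul_assoc]
  | add a b ha hb => simp only [add_mul, map_add, ha, hb, mul_add]

theorem mul_lTensor_aux (y : QPermAlg n K ⊗[K] QPermAlg n K) (p q : QPermAlg n K) :
    LinearMap.mul' K _ ((antipodeLin n K).lTensor _ (p ⊗ₜ q * y)) =
      p * LinearMap.mul' K _ ((antipodeLin n K).lTensor _ y) * antipodeLin n K q := by
  induction y using TensorProduct.induction_on with
  | zero => simp
  | tmul a b => simp [antipodeLin_mul, mul_assoc]
  | add a b ha hb => simp only [add_mul, map_add, ha, hb, mul_add]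

theorem antipode_left (a : QPermAlg n K) :
    LinearMap.mul' K _ ((antipodeLin n K).rTensor _ (comulHom n K a)) =
      algebraMap K _ (counitHom n K a) := by
  induction a using induction with
  | hK r =>
    rw [AlgHom.commutes, AlgHom.commutes, Algebra.TensorProduct.algebraMap_apply]
    simp [antipodeLin_algebraMap]
  | hu i j =>
    simp only [comulHom_u, map_sum, LinearMap.rTensor_tmul, LinearMap.mul'_apply,
      antipodeLin_u, row_mul, counitHom_u]
    by_cases h : i = j
    · subst h; simp [col_sum]
    · simp [h]
  | hmul a b ha hb =>
    rw [map_mul (comulHom n K), map_mul (counitHom n K), map_mul (algebraMap K _), ← hb]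
    generalize comulHom n K b = y
    induction y using TensorProduct.induction_on with
    | zero => simp
    | tmul p q =>
      rw [mul_rTensor_aux, ha, ← Algebra.commutes, mul_assoc]
      simp
    | add a b ha hb => simp only [map_add, ha, hb, mul_add]
  | hadd a b ha hb => simp only [map_add, ha, hb]

theorem antipode_right (a : QPermAlg n K) :
    LinearMap.mul' K _ ((antipodeLin n K).lTensor _ (comulHom n K a)) =
      algebraMap K _ (counitHom n K a) := by
  induction a using induction with
  | hK r =>
    rw [AlgHom.commutes, AlgHom.commutes, Algebra.TensorProduct.algebraMap_apply]
    have h := antipodeLin_algebraMap (n := n) (K := K) 1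
    simp only [map_one] at h
    simp [h]
  | hu i j =>
    simp only [comulHom_u, map_sum, LinearMap.lTensor_tmul, LinearMap.mul'_apply,
      antipodeLin_u, counitHom_u, col_mul]
    by_cases h : i = j
    · subst h; simp [row_sum]
    · simp [h]
  | hmul a b ha hb =>
    rw [map_mul (comulHom n K), map_mul (counitHom n K), map_mul (algebraMap K _), ← ha]
    generalize comulHom n K a = y
    induction y using TensorProduct.induction_on with
    | zero => simp
    | tmul p q =>
      rw [mul_lTensor_aux, hb, ← Algebra.commutes, mul_assoc, Algebra.commutes]
      simp
    | add a b ha hb => simp only [map_add, ha, hb, add_mul]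
  | hadd a b ha hb => simp only [map_add, ha, hb]

/-- The Hopf algebra structure of `A_s(n, K)`: `Δ(u i j) = ∑ k, u i k ⊗ u k j`,
`ε(u i j) = δ i j`, `S(u i j) = u j i`. -/
instance : HopfAlgebra K (QPermAlg n K) where
  antipode := antipodeLin n K
  mul_antipode_rTensor_comul := LinearMap.ext antipode_left
  mul_antipode_lTensor_comul := LinearMap.ext antipode_right

end

end QPermAlg

/-- A right comodule structure on the vector space `V` over the coalgebra `H`. -/
structure RightComodule (K : Type u) (H : Type v) (V : Type w) [Field K] [Ring H]
    [HopfAlgebra K H] [AddCommGroup V] [Module K V] where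
  /-- The coaction `V → V ⊗ H`. -/
  coact : V →ₗ[K] V ⊗[K] H
  coassoc : (TensorProduct.assoc K V H H).toLinearMap ∘ₗ coact.rTensor H ∘ₗ coact =
    (Coalgebra.comul (R := K) (A := H)).lTensor V ∘ₗ coact
  counit_coact : (TensorProduct.rid K V).toLinearMap ∘ₗ
    (Coalgebra.counit (R := K) (A := H)).lTensor V ∘ₗ coact = LinearMap.id

namespace RightComodule

variable {K : Type u} {H : Type v} {V : Type w} [Field K] [Ring H] [HopfAlgebra K H]
  [AddCommGroup V] [Module K V]

/-- `W` is a subcomodule if the coaction maps `W` to (the image in `V ⊗ H` of) `W ⊗ H`. -/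
def IsSubcomodule (ρ : RightComodule K H V) (W : Submodule K V) : Prop :=
  ∀ x ∈ W, ρ.coact x ∈ LinearMap.range (W.subtype.rTensor H)

/-- A comodule is semisimple if every subcomodule is a direct summand as a comodule. -/
def IsSemisimple (ρ : RightComodule K H V) : Prop :=
  ∀ W : Submodule K V, ρ.IsSubcomodule W →
    ∃ W' : Submodule K V, ρ.IsSubcomodule W' ∧ IsCompl W W'

/-- A finite-dimensional comodule over a Hopf `*`-algebra is equivalent to a unitary one if the
matrix of its coaction in a suitable basis (which is orthonormal for the corresponding inner
product) is a unitary matrix with entries in `H`. -/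
def IsUnitarizable [StarRing H] (ρ : RightComodule K H V) : Prop :=
  ∃ (d : ℕ) (b : Module.Basis (Fin d) K V) (x : Matrix (Fin d) (Fin d) H),
    (∀ j, ρ.coact (b j) = ∑ i, b i ⊗ₜ[K] x i j) ∧ x ∈ unitary (Matrix (Fin d) (Fin d) H)

end RightComodule

/-- A Hopf algebra is cosemisimple if its category of comodules is semisimple: all comodules,
of arbitrary dimension, are semisimple. The universe `w` of the comodules is a parameter. -/
def IsCosemisimple (K : Type u) (H : Type v) [Field K] [Ring H] [HopfAlgebra K H] : Prop :=
  ∀ (V : Type w) [AddCommGroup V] [Module K V] (ρ : RightComodule K H V), ρ.IsSemisimple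

/-- A Hopf `*`-algebra is a complex Hopf algebra that is a `*`-algebra (an involutive ring with
conjugate-linear involution) and whose comultiplication and counit are `*`-maps. -/
structure IsHopfStarAlgebra (H : Type v) [Ring H] [HopfAlgebra ℂ H] [StarRing H]
    [StarModule ℂ H] : Prop where
  comul_star : ∀ a : H, Coalgebra.comul (R := ℂ) (star a) = star (Coalgebra.comul (R := ℂ) a)
  counit_star : ∀ a : H, Coalgebra.counit (R := ℂ) (star a) = star (Coalgebra.counit (R := ℂ) a)

/-- A CQG algebra is a Hopf `*`-algebra all of whose finite-dimensional comodules are equivalent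
to unitary ones. -/
structure IsCQGAlgebra (H : Type v) [Ring H] [HopfAlgebra ℂ H] [StarRing H]
    [StarModule ℂ H] : Prop extends IsHopfStarAlgebra H where
  unitarizable : ∀ (V : Type w) [AddCommGroup V] [Module ℂ V] [FiniteDimensional ℂ V]
    (ρ : RightComodule ℂ H V), ρ.IsUnitarizable

/-! Both statements rest on a Haar functional: a linear `h` with `h 1 = 1` and `(id ⊗ h)Δ(a) =
h(a)1`. The algebra is spanned by entries of matrices `X` built from `u` by tensor products and
direct sums (`exists_isTensorial`), and one sets `h (X i j) = P i j`, with `P` the orthogonal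
projection onto the fixed vectors of `X`. The issue is that linear relations between the entries
must be respected (`IsTensorial.sum_fixProj_eq_zero`). Over `ℚ` this is linear algebra: transposing
the generators is an algebra endomorphism taking `X` to its transpose, so the space of relations is
stable under mutually adjoint operators, and the dot product is positive definite. The functional is
then extended to any field of characteristic zero (`exists_isHaar`).

Cosemisimplicity follows as in Maschke's theorem: strong invariance, `a₁ h(a₂ S(b)) = h(a S(b₁))
b₂`, lets a linear projection onto a subcomodule be averaged into a comodule map, whose kernel is
the complement.

Over `ℂ` the matrices `X` are unitary. Strong invariance also embeds every finite-dimensional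
corepresentation `x` into a direct sum of such `X` (`IsCorep.exists_intertwiners`). Pulling back the
standard inner product gives a positive definite `G` with `x* G x = G`, and writing `G = R* R` makes
`R x R⁻¹` unitary. -/

namespace QPermAlg

noncomputable section

variable {n : ℕ} {K : Type u} [Field K]

/-! ### Corepresentations built from the generators -/

/-- The matrix of coefficients of a finite-dimensional comodule. -/
structure IsCorep {ι : Type*} [Fintype ι] [DecidableEq ι] (X : Matrix ι ι (QPermAlg n K)) :
    Prop where
  comul : ∀ i j, comulHom n K (X i j) = ∑ k, X i k ⊗ₜ[K] X k j
  counit : ∀ i j, counitHom n K (X i j) = if i = j then 1 else 0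

variable (n K) in
/-- The multiplicative relation between words in the generators and their transposes. -/
def swapRel : Submonoid (QPermAlg n K × QPermAlg n K) :=
  -- The pair `0` accounts for the off-diagonal blocks of direct sums.
  Submonoid.closure (insert 0 (Set.range fun p : Fin n × Fin n => (u p.1 p.2, u p.2 p.1)))

/-- A corepresentation matrix whose entries are words in the generators or zero, and whose
transpose is obtained by transposing the generators. -/
structure IsTensorial {ι : Type*} [Fintype ι] [DecidableEq ι] (X : Matrix ι ι (QPermAlg n K)) :
    Prop extends IsCorep X where
  swap : ∀ i j, (X i j, X j i) ∈ swapRel n K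

theorem isTensorial_one : IsTensorial (1 : Matrix Unit Unit (QPermAlg n K)) where
  comul i j := by simp [Algebra.TensorProduct.one_def]
  counit i j := by simp
  swap i j := by
    simp only [Matrix.one_apply_eq]
    exact one_mem (swapRel n K)

theorem isTensorial_u : IsTensorial (Matrix.of fun i j : Fin n => (u i j : QPermAlg n K)) where
  comul i j := by simp
  counit i j := by simp
  swap i j := Submonoid.subset_closure (Set.mem_insert_of_mem _ ⟨(i, j), rfl⟩)

theorem IsTensorial.kronecker {ι κ : Type*} [Fintype ι] [DecidableEq ι] [Fintype κ]
    [DecidableEq κ] {X : Matrix ι ι (QPermAlg n K)} {Y : Matrix κ κ (QPermAlg n K)}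
    (hX : IsTensorial X) (hY : IsTensorial Y) :
    IsTensorial (Matrix.of fun (p q : ι × κ) => X p.1 q.1 * Y p.2 q.2) where
  comul i j := by
    simp [hX.comul, hY.comul, Finset.sum_mul_sum, Fintype.sum_prod_type]
  counit i j := by
    simp only [Matrix.of_apply, map_mul, hX.counit, hY.counit, Prod.ext_iff]
    split_ifs <;> simp_all
  swap i j := (swapRel n K).mul_mem (hX.swap i.1 j.1) (hY.swap i.2 j.2)

theorem IsTensorial.fromBlocks {ι κ : Type*} [Fintype ι] [DecidableEq ι] [Fintype κ]
    [DecidableEq κ] {X : Matrix ι ι (QPermAlg n K)} {Y : Matrix κ κ (QPermAlg n K)}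
    (hX : IsTensorial X) (hY : IsTensorial Y) :
    IsTensorial (Matrix.fromBlocks X 0 0 Y) where
  comul i j := by
    rcases i with i | i <;> rcases j with j | j <;> simp [hX.comul, hY.comul]
  counit i j := by
    rcases i with i | i <;> rcases j with j | j <;> simp [hX.counit, hY.counit]
  swap i j := by
    have h0 : (0 : QPermAlg n K × QPermAlg n K) ∈ swapRel n K :=
      Submonoid.subset_closure (Set.mem_insert _ _)
    rcases i with i | i <;> rcases j with j | j
    · exact hX.swap i j
    · exact h0
    · exact h0
    · exact hY.swap i j

/-- The algebra is spanned by the entries of tensorial corepresentation matrices. -/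
theorem exists_isTensorial (a : QPermAlg n K) :
    ∃ (ι : Type) (_ : Fintype ι) (_ : DecidableEq ι) (X : Matrix ι ι (QPermAlg n K))
      (f : ι → ι → K), IsTensorial X ∧ a = ∑ i, ∑ j, f i j • X i j := by
  induction a using induction with
  | hK r =>
    refine ⟨Unit, inferInstance, inferInstance, 1, fun _ _ => r, isTensorial_one, ?_⟩
    simp [Algebra.algebraMap_eq_smul_one]
  | hu i j =>
    refine ⟨Fin n, inferInstance, inferInstance, _,
      fun k l => if k = i then if l = j then 1 else 0 else 0, isTensorial_u, ?_⟩
    simp [ite_smul]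
  | hmul a b ha hb =>
    obtain ⟨ι, _, _, X, f, hX, rfl⟩ := ha
    obtain ⟨κ, _, _, Y, g, hY, rfl⟩ := hb
    refine ⟨ι × κ, inferInstance, inferInstance, _, fun p q => f p.1 q.1 * g p.2 q.2,
      hX.kronecker hY, ?_⟩
    simp only [Finset.sum_mul_sum, Fintype.sum_prod_type, Matrix.of_apply, smul_mul_smul_comm]
  | hadd a b ha hb =>
    obtain ⟨ι, _, _, X, f, hX, rfl⟩ := ha
    obtain ⟨κ, _, _, Y, g, hY, rfl⟩ := hb
    refine ⟨ι ⊕ κ, inferInstance, inferInstance, _, Matrix.fromBlocks (Matrix.of f) 0 0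
      (Matrix.of g), hX.fromBlocks hY, ?_⟩
    simp

theorem isMagic_transpose : IsMagic (fun i j : Fin n => (u j i : QPermAlg n K)) where
  row_mul i j k := col_mul i j k
  row_sum i := col_sum i
  col_mul i j k := row_mul i j k
  col_sum i := row_sum i

variable (n K) in
/-- Transposition of the generators as an algebra endomorphism. -/
def transposeHom : QPermAlg n K →ₐ[K] QPermAlg n K := lift _ isMagic_transpose

/-- Unlike the antipode, `transposeHom` keeps the order of factors, as `swapRel` does. It serves to
exchange rows and columns of `X` inside a functional. -/
theorem IsTensorial.transposeHom_apply {ι : Type*} [Fintype ι] [DecidableEq ι]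
    {X : Matrix ι ι (QPermAlg n K)} (hX : IsTensorial X) (i j : ι) :
    transposeHom n K (X i j) = X j i := by
  have h : ∀ p ∈ swapRel n K, transposeHom n K p.1 = p.2 := by
    intro p hp
    induction hp using Submonoid.closure_induction with
    | mem p hp =>
      rcases hp with rfl | ⟨q, rfl⟩
      · simp
      · simp [transposeHom]
    | one => simp
    | mul p q _ _ hp hq => simp [hp, hq]
  exact h _ (hX.swap i j)

/-! ### The Haar functional over the rationals -/

/-- No nonzero rational vector is orthogonal to itself, so `S` meets its orthogonal trivially. This
fails over general fields, hence the detour through `ℚ`. -/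
theorem exists_orthogonal_decomposition {κ : Type*} [Fintype κ] (S : Submodule ℚ (κ → ℚ))
    (v : κ → ℚ) : ∃ a ∈ S, ∀ s ∈ S, s ⬝ᵥ (v - a) = 0 := by
  classical
  let B : LinearMap.BilinForm ℚ (κ → ℚ) := dotProductBilin ℚ ℚ
  have hB : ∀ x y, B x y = x ⬝ᵥ y := fun _ _ => rfl
  have hs : B.IsRefl := fun x y h => by rwa [hB, dotProduct_comm]
  have hc : IsCompl S (B.orthogonal S) := by
    rw [LinearMap.BilinForm.isCompl_orthogonal_iff_disjoint hs, Submodule.disjoint_def]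
    intro x hx hx'
    exact dotProduct_self_eq_zero.1 (hx' x hx)
  obtain ⟨a, b, ha, hb, h⟩ := (Submodule.codisjoint_iff_exists_add_eq.1 hc.codisjoint) v
  refine ⟨a, ha, fun s hs => ?_⟩
  rw [← h, add_sub_cancel_left]
  exact hb s hs

/-- `P` is the orthogonal projection onto the fixed vectors of `X`. -/
structure IsFixProj {ι : Type*} [Fintype ι] (X : Matrix ι ι (QPermAlg n ℚ)) (P : ι → ι → ℚ) :
    Prop where
  symm : ∀ i j, P i j = P j i
  fixed : ∀ i j, ∑ k, P k j • X i k = P i j • 1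
  of_fixed : ∀ v : ι → ℚ, (∀ i, ∑ k, v k • X i k = v i • 1) → ∀ i, ∑ k, P i k * v k = v i

theorem exists_isFixProj {ι : Type*} [Fintype ι] [DecidableEq ι]
    (X : Matrix ι ι (QPermAlg n ℚ)) : ∃ P, IsFixProj X P := by
  let S : Submodule ℚ (ι → ℚ) :=
    { carrier := {v | ∀ i, ∑ k, v k • X i k = v i • 1}
      zero_mem' := by simp
      add_mem' := by
        intro v w hv hw i
        simp [add_smul, Finset.sum_add_distrib, hv i, hw i]
      smul_mem' := by
        intro c v hv i
        simp only [Pi.smul_apply, smul_eq_mul, mul_smul, ← Finset.smul_sum, hv i] }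
  -- The vector `a j`, the projection of the `j`-th basis vector, is the `j`-th column of `P`.
  choose a ha ha' using fun j => exists_orthogonal_decomposition S (Pi.single j 1)
  have key : ∀ v ∈ S, ∀ j, v ⬝ᵥ a j = v j := by
    intro v hv j
    have := ha' j v hv
    rw [dotProduct_sub, sub_eq_zero] at this
    simp [← this]
  have hsymm : ∀ i j, a j i = a i j := by
    intro i j
    rw [← key _ (ha j) i, ← key _ (ha i) j, dotProduct_comm]
  refine ⟨fun i j => a j i, ⟨hsymm, fun i j => ha j i, fun v hv i => ?_⟩⟩
  rw [← key v hv i, dotProduct_comm]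
  simp [dotProduct, hsymm i]

theorem IsFixProj.fromBlocks {ι κ : Type*} [Fintype ι] [Fintype κ]
    {X : Matrix ι ι (QPermAlg n ℚ)} {Y : Matrix κ κ (QPermAlg n ℚ)} {P : ι → ι → ℚ}
    {Q : κ → κ → ℚ} (hX : IsFixProj X P) (hY : IsFixProj Y Q) :
    IsFixProj (Matrix.fromBlocks X 0 0 Y)
      (Matrix.fromBlocks (Matrix.of P) 0 0 (Matrix.of Q)) where
  symm i j := by
    rcases i with i | i <;> rcases j with j | j <;>
      first | exact hX.symm i j | exact hY.symm i j | rfl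
  fixed i j := by
    rcases i with i | i <;> rcases j with j | j <;> simp [hX.fixed, hY.fixed]
  of_fixed v hv i := by
    rcases i with i | i
    · simpa using hX.of_fixed (fun k => v (Sum.inl k)) (fun i => by simpa using hv (Sum.inl i)) i
    · simpa using hY.of_fixed (fun k => v (Sum.inr k)) (fun i => by simpa using hv (Sum.inr i)) i

/-- This is the well-definedness of `h`. The matrix product `f P` is shown to be a relation again;
since the columns of `P` are fixed by `X`, that relation reads `(∑ f i j * P i j) • 1 = 0`. -/
theorem IsTensorial.sum_fixProj_eq_zero {ι : Type*} [Fintype ι] [DecidableEq ι]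
    {X : Matrix ι ι (QPermAlg n ℚ)} (hX : IsTensorial X) {P : ι → ι → ℚ} (hP : IsFixProj X P)
    (f : ι → ι → ℚ) (hf : ∑ i, ∑ j, f i j • X i j = 0) : ∑ i, ∑ j, f i j * P i j = 0 := by
  let N : Submodule ℚ (ι × ι → ℚ) :=
    { carrier := {f | ∑ i, ∑ j, f (i, j) • X i j = 0}
      zero_mem' := by simp
      add_mem' := by
        intro v w hv hw
        simp only [Set.mem_ofPred_eq, Pi.add_apply, add_smul, Finset.sum_add_distrib] at *
        rw [hv, hw, add_zero]
      smul_mem' := by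
        intro c v hv
        simp only [Set.mem_ofPred_eq, Pi.smul_apply, smul_eq_mul, mul_smul,
          ← Finset.smul_sum] at *
        rw [hv, smul_zero] }
  -- `R φ` is the effect on coefficients of applying `(id ⊗ φ)Δ` to `∑ f (i, j) • X i j`; `L φ` is
  -- its adjoint.
  let R (φ : QPermAlg n ℚ →ₗ[ℚ] ℚ) (f : ι × ι → ℚ) : ι × ι → ℚ :=
    fun p => ∑ q, f (p.1, q) * φ (X p.2 q)
  let L (φ : QPermAlg n ℚ →ₗ[ℚ] ℚ) (f : ι × ι → ℚ) : ι × ι → ℚ :=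
    fun p => ∑ q, f (p.1, q) * φ (X q p.2)
  have hRsub : ∀ φ x y, R φ (x - y) = R φ x - R φ y := by
    intro φ x y
    funext p
    simp [R, sub_mul]
  have hR : ∀ φ, ∀ x ∈ N, R φ x ∈ N := by
    intro φ x hx
    have hx' : ∑ i, ∑ j, x (i, j) • X i j = 0 := hx
    have h := congrArg (fun a => TensorProduct.rid ℚ _ (φ.lTensor _ (comulHom n ℚ a))) hx'
    simp only [map_sum, map_smul, hX.comul, map_zero, LinearMap.lTensor_tmul,
      TensorProduct.rid_tmul] at h
    change ∑ i, ∑ j, (∑ q, x (i, q) * φ (X j q)) • X i j = 0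
    rw [← h]
    refine Finset.sum_congr rfl fun i _ => ?_
    simp only [Finset.sum_smul, Finset.smul_sum, mul_smul]
    exact Finset.sum_comm
  have hL : ∀ φ, ∀ x ∈ N, L φ x ∈ N := by
    intro φ x hx
    -- On these coefficients `L φ` is `R` of `φ` composed with transposition.
    have := hR (φ ∘ₗ (transposeHom n ℚ).toLinearMap) x hx
    simpa [R, L, hX.transposeHom_apply] using this
  have hLR : ∀ φ x y, L φ x ⬝ᵥ y = x ⬝ᵥ R φ y := by
    intro φ x y
    simp only [dotProduct, L, R, Fintype.sum_prod_type, Finset.sum_mul, Finset.mul_sum]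
    refine Finset.sum_congr rfl fun i _ => ?_
    rw [Finset.sum_comm]
    refine Finset.sum_congr rfl fun j _ => Finset.sum_congr rfl fun k _ => ?_
    ring
  let g : ι × ι → ℚ := fun p => f p.1 p.2
  have hg : g ∈ N := hf
  let gP : ι × ι → ℚ := fun p => ∑ k, f p.1 k * P k p.2
  have hRP : ∀ φ, R φ gP = φ 1 • gP := by
    intro φ
    funext p
    have h1 : ∀ k, ∑ q, P q k * φ (X p.2 q) = P p.2 k * φ 1 := by
      intro k
      have := congrArg φ (hP.fixed p.2 k)
      simpa using this
    calc ∑ q, (∑ k, f p.1 k * P k q) * φ (X p.2 q)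
        = ∑ k, f p.1 k * ∑ q, P q k * φ (X p.2 q) := by
          simp only [Finset.sum_mul, Finset.mul_sum]
          rw [Finset.sum_comm]
          refine Finset.sum_congr rfl fun j _ => Finset.sum_congr rfl fun k _ => ?_
          rw [hP.symm j k]
          ring
      _ = φ 1 * ∑ k, f p.1 k * P k p.2 := by
          simp only [h1, Finset.mul_sum]
          refine Finset.sum_congr rfl fun j _ => ?_
          rw [hP.symm j p.2]
          ring
  obtain ⟨a, ha, hab⟩ := exists_orthogonal_decomposition N gP
  set b := gP - a with hb
  -- The difference of the two sides lies in `N` because `gP` satisfies the identity and `a ∈ N`; it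
  -- is orthogonal to `N` because `L φ` preserves `N`.
  have hfix : ∀ φ, R φ b = φ 1 • b := by
    intro φ
    have hmem : R φ b - φ 1 • b ∈ N := by
      have : R φ b - φ 1 • b = φ 1 • a - R φ a := by
        rw [hb, hRsub, hRP, smul_sub]
        abel
      rw [this]
      exact N.sub_mem (N.smul_mem _ ha) (hR φ a ha)
    have horth : ∀ s ∈ N, s ⬝ᵥ (R φ b - φ 1 • b) = 0 := by
      intro s hs
      rw [dotProduct_sub, dotProduct_smul, hab s hs, ← hLR, hab _ (hL φ s hs)]
      simp
    exact sub_eq_zero.1 (dotProduct_self_eq_zero.1 (horth _ hmem))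
  -- Functionals separate points, so `hfix` says that each row of `b` is a fixed vector of `X`.
  have hbP : ∀ i j, ∑ k, P j k * b (i, k) = b (i, j) := by
    intro i
    refine hP.of_fixed (fun k => b (i, k)) fun j => ?_
    rw [← sub_eq_zero, ← Module.forall_dual_apply_eq_zero_iff ℚ]
    intro φ
    have := congrFun (hfix φ) (i, j)
    simp only [R, Pi.smul_apply, smul_eq_mul] at this
    rw [map_sub, map_sum, sub_eq_zero]
    simp only [map_smul, smul_eq_mul]
    rw [mul_comm (b _)]
    exact this
  -- As `P` is symmetric and fixes the rows of `b`, it can be moved off `gP`, leaving `g ⬝ᵥ b`,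
  -- where `g ∈ N`.
  have hb0 : b = 0 := by
    rw [← dotProduct_self_eq_zero]
    calc b ⬝ᵥ b = gP ⬝ᵥ b - a ⬝ᵥ b := by rw [← sub_dotProduct]
      _ = gP ⬝ᵥ b := by rw [hab a ha, sub_zero]
      _ = g ⬝ᵥ b := by
        simp only [dotProduct, Fintype.sum_prod_type, gP, g]
        refine Finset.sum_congr rfl fun i _ => ?_
        calc ∑ j, (∑ k, f i k * P k j) * b (i, j)
            = ∑ k, f i k * ∑ j, P k j * b (i, j) := by
              simp only [Finset.sum_mul, Finset.mul_sum, mul_assoc]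
              exact Finset.sum_comm
          _ = ∑ k, f i k * b (i, k) := by simp only [hbP]
      _ = 0 := hab g hg
  have hgP : gP ∈ N := by
    rw [sub_eq_zero.1 (hb.symm.trans hb0)]
    exact ha
  have hgP' : ∑ i, ∑ j, (∑ k, f i k * P k j) • X i j = 0 := hgP
  have hone : (1 : QPermAlg n ℚ) ≠ 0 := by
    intro h
    have := congrArg (counitHom n ℚ) h
    simp at this
  have : (∑ i, ∑ j, f i j * P i j) • (1 : QPermAlg n ℚ) = 0 := by
    rw [← hgP']
    simp only [Finset.sum_smul]
    refine Finset.sum_congr rfl fun i _ => ?_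
    rw [Finset.sum_comm]
    refine Finset.sum_congr rfl fun k _ => ?_
    rw [mul_smul, ← hP.fixed, Finset.smul_sum]
    refine Finset.sum_congr rfl fun j _ => ?_
    rw [mul_smul, hP.symm k j]
  exact (smul_eq_zero.1 this).resolve_right hone

/-- `h` is a normalised invariant functional. -/
structure IsHaar (h : QPermAlg n K →ₗ[K] K) : Prop where
  one : h 1 = 1
  invariant : ∀ a, TensorProduct.rid K _ (h.lTensor _ (comulHom n K a)) = h a • 1

/-- The relation `r a c` says that some expansion of `a` gives the value `c`. Direct sums make `r`
additive, so its uniqueness reduces to `a = 0`. Invariance is the fact that the columns of `P` are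
fixed. -/
theorem exists_isHaar_rat (n : ℕ) : ∃ h : QPermAlg n ℚ →ₗ[ℚ] ℚ, IsHaar h := by
  let r (a : QPermAlg n ℚ) (c : ℚ) : Prop :=
    ∃ (ι : Type) (_ : Fintype ι) (_ : DecidableEq ι) (X : Matrix ι ι (QPermAlg n ℚ))
      (f P : ι → ι → ℚ), IsTensorial X ∧ IsFixProj X P ∧ a = ∑ i, ∑ j, f i j • X i j ∧
        c = ∑ i, ∑ j, f i j * P i j
  have hadd : ∀ a b c d, r a c → r b d → r (a + b) (c + d) := by
    rintro _ _ _ _ ⟨ι, _, _, X, f, P, hX, hP, rfl, rfl⟩ ⟨κ, _, _, Y, g, Q, hY, hQ, rfl, rfl⟩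
    exact ⟨ι ⊕ κ, inferInstance, inferInstance, _, Matrix.fromBlocks (Matrix.of f) 0 0
      (Matrix.of g), _, hX.fromBlocks hY, hP.fromBlocks hQ, by simp, by simp⟩
  have hsmul : ∀ (t : ℚ) a c, r a c → r (t • a) (t * c) := by
    rintro t _ _ ⟨ι, _, _, X, f, P, hX, hP, rfl, rfl⟩
    exact ⟨ι, inferInstance, inferInstance, X, fun i j => t * f i j, P, hX, hP,
      by simp only [Finset.smul_sum, mul_smul], by simp only [Finset.mul_sum, mul_assoc]⟩
  have hzero : ∀ c, r 0 c → c = 0 := by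
    rintro _ ⟨ι, _, _, X, f, P, hX, hP, h, rfl⟩
    exact hX.sum_fixProj_eq_zero hP f h.symm
  have huniq : ∀ a c d, r a c → r a d → c = d := by
    intro a c d hc hd
    have := hadd _ _ _ _ hc (hsmul (-1) _ _ hd)
    rw [neg_one_smul, add_neg_cancel] at this
    linarith [hzero _ this]
  have hex : ∀ a, ∃ c, r a c := by
    intro a
    obtain ⟨ι, _, _, X, f, hX, rfl⟩ := exists_isTensorial a
    obtain ⟨P, hP⟩ := exists_isFixProj X
    exact ⟨_, ι, inferInstance, inferInstance, X, f, P, hX, hP, rfl, rfl⟩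
  choose h hh using hex
  let H : QPermAlg n ℚ →ₗ[ℚ] ℚ :=
    { toFun := h
      map_add' := fun a b => huniq _ _ _ (hh _) (hadd _ _ _ _ (hh a) (hh b))
      map_smul' := fun t a => huniq _ _ _ (hh _) (hsmul t _ _ (hh a)) }
  have hH : ∀ {ι : Type} [Fintype ι] [DecidableEq ι] {X : Matrix ι ι (QPermAlg n ℚ)}
      {P : ι → ι → ℚ}, IsTensorial X → IsFixProj X P → ∀ i j, H (X i j) = P i j := by
    intro ι _ _ X P hX hP i j
    refine huniq _ _ _ (hh _) ⟨ι, inferInstance, inferInstance, X,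
      fun k l => if k = i then if l = j then 1 else 0 else 0, P, hX, hP, ?_, ?_⟩
    · simp [ite_smul]
    · simp
  refine ⟨H, ?_, ?_⟩
  · have hP : IsFixProj (1 : Matrix Unit Unit (QPermAlg n ℚ)) (fun _ _ => 1) :=
      ⟨by simp, by simp, by simp⟩
    simpa using hH isTensorial_one hP () ()
  · intro a
    obtain ⟨ι, _, _, X, f, hX, rfl⟩ := exists_isTensorial a
    obtain ⟨P, hP⟩ := exists_isFixProj X
    simp only [map_sum, map_smul, hX.comul, LinearMap.lTensor_tmul, TensorProduct.rid_tmul,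
      hH hX hP, hP.fixed, Finset.sum_smul, smul_assoc]

/-! ### Base change -/

theorem IsMagic.map {B : Type v} {C : Type w} [Ring B] [Ring C] {x : Fin n → Fin n → B}
    (hx : IsMagic x) (φ : B →+* C) : IsMagic (fun i j => φ (x i j)) where
  row_mul i j k := by rw [← map_mul, hx.row_mul]; split_ifs <;> simp
  row_sum i := by rw [← map_sum, hx.row_sum, map_one]
  col_mul i j k := by rw [← map_mul, hx.col_mul]; split_ifs <;> simp
  col_sum i := by rw [← map_sum, hx.col_sum, map_one]

theorem isMagic_u : IsMagic (fun i j : Fin n => (u i j : QPermAlg n K)) :=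
  ⟨row_mul, row_sum, col_mul, col_sum⟩

variable (n K) in
/-- The canonical ring homomorphism from the rational form of the algebra. -/
def ratHom [CharZero K] : QPermAlg n ℚ →+* QPermAlg n K :=
  letI : Algebra ℚ (QPermAlg n K) := Algebra.compHom _ (algebraMap ℚ K)
  (lift (K := ℚ) _ (isMagic_u (n := n) (K := K))).toRingHom

@[simp]
theorem ratHom_u [CharZero K] (i j : Fin n) : ratHom n K (u i j) = u i j := by
  let : Algebra ℚ (QPermAlg n K) := Algebra.compHom _ (algebraMap ℚ K)
  exact lift_u (K := ℚ) _ (isMagic_u (n := n) (K := K)) i j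

theorem ringHom_rat_ext {B : Type v} [Ring B] [Algebra K B] [CharZero K]
    {f g : QPermAlg n ℚ →+* B} (h : ∀ i j, f (u i j) = g (u i j)) : f = g := by
  let : Algebra ℚ B := Algebra.compHom _ (algebraMap ℚ K)
  have := algHom_ext (f := f.toRatAlgHom) (g := g.toRatAlgHom) h
  exact congrArg AlgHom.toRingHom this

theorem exists_ratHom_tensor (n : ℕ) (K : Type u) [Field K] [CharZero K] :
    ∃ μ : QPermAlg n ℚ ⊗[ℚ] QPermAlg n ℚ →+* QPermAlg n K ⊗[K] QPermAlg n K,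
      ∀ a b, μ (a ⊗ₜ b) = ratHom n K a ⊗ₜ ratHom n K b := by
  let : Algebra ℚ (QPermAlg n K ⊗[K] QPermAlg n K) := Algebra.compHom _ (algebraMap ℚ K)
  let f : QPermAlg n ℚ →+* QPermAlg n K ⊗[K] QPermAlg n K :=
    (Algebra.TensorProduct.includeLeftRingHom).comp (ratHom n K)
  let g : QPermAlg n ℚ →+* QPermAlg n K ⊗[K] QPermAlg n K :=
    (Algebra.TensorProduct.includeRight : QPermAlg n K →ₐ[K] _).toRingHom.comp (ratHom n K)
  refine ⟨(Algebra.TensorProduct.lift f.toRatAlgHom g.toRatAlgHom fun x y => ?_).toRingHom,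
    fun a b => ?_⟩
  · simp [f, g, Commute, SemiconjBy]
  · simp [f, g]

theorem span_range_ratHom (n : ℕ) (K : Type u) [Field K] [CharZero K] :
    Submodule.span K (Set.range (ratHom n K)) = ⊤ := by
  rw [eq_top_iff]
  rintro a -
  induction a using induction with
  | hK r =>
    rw [Algebra.algebraMap_eq_smul_one]
    exact Submodule.smul_mem _ _ (Submodule.subset_span ⟨1, map_one _⟩)
  | hu i j => exact Submodule.subset_span ⟨u i j, ratHom_u i j⟩
  | hmul a b ha hb =>
    have := Submodule.mul_mem_mul ha hb
    rw [Submodule.span_mul_span] at this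
    refine Submodule.span_mono ?_ this
    rintro _ ⟨_, ⟨x, rfl⟩, _, ⟨y, rfl⟩, rfl⟩
    exact ⟨x * y, map_mul _ _ _⟩
  | hadd a b ha hb => exact Submodule.add_mem _ ha hb

/-- Only a map `β` to `K ⊗ QPermAlg n ℚ` is needed, not an isomorphism: the image of the rational
form spans over `K`, and invariance is linear. -/
theorem exists_isHaar (n : ℕ) (K : Type u) [Field K] [CharZero K] :
    ∃ h : QPermAlg n K →ₗ[K] K, IsHaar h := by
  obtain ⟨h, hh⟩ := exists_isHaar_rat n
  let β : QPermAlg n K →ₐ[K] K ⊗[ℚ] QPermAlg n ℚ :=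
    lift _ ((isMagic_u (n := n) (K := ℚ)).map
      (Algebra.TensorProduct.includeRight : QPermAlg n ℚ →ₐ[ℚ] K ⊗[ℚ] QPermAlg n ℚ).toRingHom)
  have hβ : ∀ a, β (ratHom n K a) = 1 ⊗ₜ a := by
    have : β.toRingHom.comp (ratHom n K) = (Algebra.TensorProduct.includeRight :
        QPermAlg n ℚ →ₐ[ℚ] K ⊗[ℚ] QPermAlg n ℚ).toRingHom := by
      refine ringHom_rat_ext (K := K) fun i j => ?_
      simp [β]
    exact fun a => DFunLike.congr_fun this a
  let H : QPermAlg n K →ₗ[K] K :=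
    (TensorProduct.AlgebraTensorModule.rid ℚ K K).toLinearMap ∘ₗ h.baseChange K ∘ₗ β.toLinearMap
  have hH : ∀ a, H (ratHom n K a) = (h a : K) := by
    intro a
    simp [H, hβ, Algebra.smul_def]
  refine ⟨H, ?_, ?_⟩
  · rw [← map_one (ratHom n K), hH, hh.one, Rat.cast_one]
  · obtain ⟨μ, hμ⟩ := exists_ratHom_tensor n K
    have hΔ : ∀ a, comulHom n K (ratHom n K a) = μ (comulHom n ℚ a) := by
      have : (comulHom n K).toRingHom.comp (ratHom n K) = μ.comp (comulHom n ℚ).toRingHom := by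
        refine ringHom_rat_ext (K := K) fun i j => ?_
        simp [hμ]
      exact fun a => DFunLike.congr_fun this a
    have hr : ∀ (q : ℚ) (a : QPermAlg n ℚ), ratHom n K (q • a) = (q : K) • ratHom n K a := by
      intro q a
      rw [Algebra.smul_def, map_mul, Algebra.smul_def]
      congr 1
      have : (ratHom n K).comp (algebraMap ℚ _) = (algebraMap K _).comp (algebraMap ℚ K) :=
        Subsingleton.elim _ _
      exact DFunLike.congr_fun this q
    have hid : ∀ t, TensorProduct.rid K _ (H.lTensor _ (μ t)) =
        ratHom n K (TensorProduct.rid ℚ _ (h.lTensor _ t)) := by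
      intro t
      induction t using TensorProduct.induction_on with
      | zero => simp
      | tmul a b => simp [hμ, hH, hr]
      | add a b ha hb => simp only [map_add, ha, hb]
    intro a
    have ha : a ∈ Submodule.span K (Set.range (ratHom n K)) := by
      rw [span_range_ratHom]
      trivial
    induction ha using Submodule.span_induction with
    | mem a ha =>
      obtain ⟨a, rfl⟩ := ha
      rw [hΔ, hid, hh.invariant, hr, map_one, hH]
    | zero => simp
    | add a b _ _ ha hb => simp only [map_add, ha, hb, add_smul]
    | smul c a _ ha => simp only [map_smul, ha, smul_assoc]

/-! ### Strong invariance -/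

/-- Both sides are antimultiplicative in `a`, so the generators suffice. -/
theorem comulHom_antipodeLin (a : QPermAlg n K) :
    comulHom n K (antipodeLin n K a) =
      TensorProduct.comm K _ _ (TensorProduct.map (antipodeLin n K) (antipodeLin n K)
        (comulHom n K a)) := by
  have hmul : ∀ s t : QPermAlg n K ⊗[K] QPermAlg n K,
      TensorProduct.comm K _ _ (TensorProduct.map (antipodeLin n K) (antipodeLin n K) (s * t)) =
      TensorProduct.comm K _ _ (TensorProduct.map (antipodeLin n K) (antipodeLin n K) t) *
      TensorProduct.comm K _ _ (TensorProduct.map (antipodeLin n K) (antipodeLin n K) s) := by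
    intro s t
    induction s using TensorProduct.induction_on with
    | zero => simp
    | add a b ha hb => simp only [add_mul, map_add, ha, hb, mul_add]
    | tmul a b =>
      induction t using TensorProduct.induction_on with
      | zero => simp
      | add a b ha hb => simp only [add_mul, map_add, ha, hb, mul_add]
      | tmul c d => simp [antipodeLin_mul]
  induction a using induction with
  | hK r =>
    rw [antipodeLin_algebraMap, AlgHom.commutes, Algebra.TensorProduct.algebraMap_apply]
    have h := antipodeLin_algebraMap (n := n) (K := K) 1
    rw [map_one] at h
    simp [h, Algebra.algebraMap_eq_smul_one, TensorProduct.smul_tmul']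
  | hu i j => simp
  | hmul a b ha hb => rw [antipodeLin_mul, map_mul, ha, hb, map_mul, hmul]
  | hadd a b ha hb => simp only [map_add, ha, hb]

theorem IsCorep.antipode_mul {ι : Type*} [Fintype ι] [DecidableEq ι]
    {X : Matrix ι ι (QPermAlg n K)} (hX : IsCorep X) (i j : ι) :
    ∑ k, antipodeLin n K (X i k) * X k j = if i = j then 1 else 0 := by
  have := antipode_left (X i j)
  rw [hX.comul, hX.counit] at this
  simp only [map_sum, LinearMap.rTensor_tmul, LinearMap.mul'_apply] at this
  rw [this]
  split_ifs <;> simp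

theorem IsCorep.mul_antipode {ι : Type*} [Fintype ι] [DecidableEq ι]
    {X : Matrix ι ι (QPermAlg n K)} (hX : IsCorep X) (i j : ι) :
    ∑ k, X i k * antipodeLin n K (X k j) = if i = j then 1 else 0 := by
  have := antipode_right (X i j)
  rw [hX.comul, hX.counit] at this
  simp only [map_sum, LinearMap.lTensor_tmul, LinearMap.mul'_apply] at this
  rw [this]
  split_ifs <;> simp

/-- Invariance is applied to `X i j * S (Y k m)`; multiplying on the right by `Y m l` and summing
over `m` cancels the surviving `S (Y s m)`. -/
theorem IsHaar.strong_invariant_corep {h : QPermAlg n K →ₗ[K] K} (hh : IsHaar h)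
    {ι κ : Type*} [Fintype ι] [DecidableEq ι] [Fintype κ] [DecidableEq κ]
    {X : Matrix ι ι (QPermAlg n K)} (hX : IsCorep X) {Y : Matrix κ κ (QPermAlg n K)}
    (hY : IsCorep Y) (i j : ι) (k l : κ) :
    ∑ r, h (X r j * antipodeLin n K (Y k l)) • X i r =
      ∑ m, h (X i j * antipodeLin n K (Y k m)) • Y m l := by
  have h1 : ∀ m, ∑ r, ∑ s, h (X r j * antipodeLin n K (Y k s)) •
      (X i r * antipodeLin n K (Y s m)) = h (X i j * antipodeLin n K (Y k m)) • 1 := by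
    intro m
    rw [← hh.invariant, map_mul, comulHom_antipodeLin, hX.comul, hY.comul]
    simp only [map_sum, TensorProduct.map_tmul, TensorProduct.comm_tmul, Finset.sum_mul_sum,
      Algebra.TensorProduct.tmul_mul_tmul, LinearMap.lTensor_tmul, TensorProduct.rid_tmul]
  calc ∑ r, h (X r j * antipodeLin n K (Y k l)) • X i r
      = ∑ m, (∑ r, ∑ s, h (X r j * antipodeLin n K (Y k s)) •
          (X i r * antipodeLin n K (Y s m))) * Y m l := by
        simp only [Finset.sum_mul]
        rw [Finset.sum_comm]
        refine Finset.sum_congr rfl fun r _ => ?_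
        rw [Finset.sum_comm]
        simp only [smul_mul_assoc, mul_assoc, ← Finset.smul_sum, ← Finset.mul_sum,
          hY.antipode_mul]
        simp
    _ = _ := by simp only [h1, smul_mul_assoc, one_mul]

/-- The bilinear form `(a, b) ↦ h (a * S b)`. -/
def antipodePairing (h : QPermAlg n K →ₗ[K] K) : QPermAlg n K →ₗ[K] QPermAlg n K →ₗ[K] K :=
  ((LinearMap.mul K (QPermAlg n K)).compr₂ h).compl₂ (antipodeLin n K)

@[simp]
theorem antipodePairing_apply (h : QPermAlg n K →ₗ[K] K) (a b : QPermAlg n K) :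
    antipodePairing h a b = h (a * antipodeLin n K b) := rfl

theorem IsHaar.strong_invariant {h : QPermAlg n K →ₗ[K] K} (hh : IsHaar h)
    (a b : QPermAlg n K) :
    TensorProduct.rid K _ (((antipodePairing h).flip b).lTensor _ (comulHom n K a)) =
    TensorProduct.lid K _ ((antipodePairing h a).rTensor _ (comulHom n K b)) := by
  let L : QPermAlg n K →ₗ[K] QPermAlg n K →ₗ[K] QPermAlg n K :=
    LinearMap.mk₂ K
      (fun a b => TensorProduct.rid K _ (((antipodePairing h).flip b).lTensor _ (comulHom n K a)))
      (fun a a' b => by simp only [map_add]) (fun c a b => by simp only [map_smul])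
      (fun a b b' => by simp only [map_add, LinearMap.lTensor_add, LinearMap.add_apply])
      (fun c a b => by simp only [map_smul, LinearMap.lTensor_smul, LinearMap.smul_apply])
  let R : QPermAlg n K →ₗ[K] QPermAlg n K →ₗ[K] QPermAlg n K :=
    LinearMap.mk₂ K
      (fun a b => TensorProduct.lid K _ ((antipodePairing h a).rTensor _ (comulHom n K b)))
      (fun a a' b => by simp only [map_add, LinearMap.rTensor_add, LinearMap.add_apply])
      (fun c a b => by simp only [map_smul, LinearMap.rTensor_smul, LinearMap.smul_apply])
      (fun a b b' => by simp only [map_add]) (fun c a b => by simp only [map_smul])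
  change L a b = R a b
  obtain ⟨ι, _, _, X, f, hX, rfl⟩ := exists_isTensorial a
  obtain ⟨κ, _, _, Y, g, hY, rfl⟩ := exists_isTensorial b
  have key : ∀ i j k l, L (X i j) (Y k l) = R (X i j) (Y k l) := by
    intro i j k l
    have := hh.strong_invariant_corep hX.toIsCorep hY.toIsCorep i j k l
    simpa [L, R, hX.comul, hY.comul] using this
  simp only [map_sum, map_smul, LinearMap.sum_apply, LinearMap.smul_apply, key]

/-! ### Averaging over the Haar functional -/

section Average

variable {V : Type w} [AddCommGroup V] [Module K V]

/-- The map `(v ⊗ b, a) ↦ h (b * S a) • v`. -/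
def slice (h : QPermAlg n K →ₗ[K] K) : V ⊗[K] QPermAlg n K →ₗ[K] QPermAlg n K →ₗ[K] V :=
  TensorProduct.lift (LinearMap.mk₂ K (fun v b => (antipodePairing h b).smulRight v)
    (fun v v' b => by ext; simp) (fun c v b => LinearMap.ext fun _ => smul_comm _ _ _)
    (fun v b b' => by ext; simp [add_smul]) (fun c v b => by ext; simp [mul_smul]))

@[simp]
theorem slice_tmul (h : QPermAlg n K →ₗ[K] K) (v : V) (a b : QPermAlg n K) :
    slice h (v ⊗ₜ b) a = h (b * antipodeLin n K a) • v := rfl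

/-- The map `v ⊗ a ↦ p(v)₀ h (p(v)₁ S a)`, whose composite with the coaction averages `p`. -/
def average (h : QPermAlg n K →ₗ[K] K) (ρ : RightComodule K (QPermAlg n K) V) (p : V →ₗ[K] V) :
    V ⊗[K] QPermAlg n K →ₗ[K] V :=
  TensorProduct.lift (slice h ∘ₗ ρ.coact ∘ₗ p)

@[simp]
theorem average_tmul (h : QPermAlg n K →ₗ[K] K) (ρ : RightComodule K (QPermAlg n K) V)
    (p : V →ₗ[K] V) (v : V) (a : QPermAlg n K) :
    average h ρ p (v ⊗ₜ a) = slice h (ρ.coact (p v)) a := rfl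

variable (ρ : RightComodule K (QPermAlg n K) V)

theorem coassoc_apply (v : V) :
    TensorProduct.assoc K V _ _ (ρ.coact.rTensor _ (ρ.coact v)) =
      (comulHom n K).toLinearMap.lTensor V (ρ.coact v) :=
  LinearMap.congr_fun ρ.coassoc v

theorem counit_coact_apply (v : V) :
    TensorProduct.rid K V ((counitHom n K).toLinearMap.lTensor V (ρ.coact v)) = v :=
  LinearMap.congr_fun ρ.counit_coact v

/-- For `t = ρ(w)`, coassociativity turns the right side into the left side of `IsHaar.slice_comul`,
which strong invariance evaluates. -/
theorem coact_slice (h : QPermAlg n K →ₗ[K] K) (a : QPermAlg n K) (t : V ⊗[K] QPermAlg n K) :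
    ρ.coact (slice h t a) =
      (TensorProduct.rid K (QPermAlg n K)).toLinearMap.lTensor V
        ((((antipodePairing h).flip a).lTensor _).lTensor V
          (TensorProduct.assoc K V _ _ (ρ.coact.rTensor _ t))) := by
  induction t using TensorProduct.induction_on with
  | zero => simp
  | add s t hs ht => simp only [map_add, LinearMap.add_apply, hs, ht]
  | tmul v b =>
    simp only [slice_tmul, map_smul, LinearMap.rTensor_tmul]
    generalize ρ.coact v = s
    induction s using TensorProduct.induction_on with
    | zero => simp
    | add s t hs ht => simp only [map_add, hs, ht, smul_add, TensorProduct.add_tmul]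
    | tmul v c => simp

theorem IsHaar.slice_comul {h : QPermAlg n K →ₗ[K] K} (hh : IsHaar h) (a : QPermAlg n K)
    (t : V ⊗[K] QPermAlg n K) :
    (TensorProduct.rid K (QPermAlg n K)).toLinearMap.lTensor V
      ((((antipodePairing h).flip a).lTensor _).lTensor V
        ((comulHom n K).toLinearMap.lTensor V t)) =
    (slice h t).rTensor _ (comulHom n K a) := by
  induction t using TensorProduct.induction_on with
  | zero => simp
  | add s t hs ht => simp only [map_add, hs, ht, LinearMap.rTensor_add, LinearMap.add_apply]
  | tmul v b =>
    have := congrArg (fun z => v ⊗ₜ[K] z) (hh.strong_invariant b a)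
    simp only [LinearMap.lTensor_tmul, AlgHom.toLinearMap_apply, LinearEquiv.coe_coe] at this ⊢
    rw [this]
    generalize comulHom n K a = s
    induction s using TensorProduct.induction_on with
    | zero => simp
    | add s t hs ht => simp only [map_add, TensorProduct.tmul_add, hs, ht]
    | tmul v c => simp [TensorProduct.smul_tmul]

/-- The averaged map is a comodule map. -/
theorem IsHaar.coact_average {h : QPermAlg n K →ₗ[K] K} (hh : IsHaar h) (p : V →ₗ[K] V) (v : V) :
    ρ.coact (average h ρ p (ρ.coact v)) =
      (average h ρ p ∘ₗ ρ.coact).rTensor _ (ρ.coact v) := by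
  have key : ∀ t : V ⊗[K] QPermAlg n K, ρ.coact (average h ρ p t) =
      (average h ρ p).rTensor _ ((TensorProduct.assoc K V _ _).symm
        ((comulHom n K).toLinearMap.lTensor V t)) := by
    intro t
    induction t using TensorProduct.induction_on with
    | zero => simp
    | add s t hs ht => simp only [map_add, hs, ht]
    | tmul v a =>
      rw [average_tmul, coact_slice, coassoc_apply, hh.slice_comul]
      simp only [LinearMap.lTensor_tmul, AlgHom.toLinearMap_apply]
      generalize comulHom n K a = s
      induction s using TensorProduct.induction_on with
      | zero => simp
      | add s t hs ht => simp only [map_add, TensorProduct.tmul_add, hs, ht]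
      | tmul v c => simp
  rw [key, ← coassoc_apply, LinearEquiv.symm_apply_apply, LinearMap.rTensor_comp_apply]

theorem average_mem (h : QPermAlg n K →ₗ[K] K) {p : V →ₗ[K] V} {W : Submodule K V}
    (hW : ρ.IsSubcomodule W) (hp : ∀ v, p v ∈ W) (t : V ⊗[K] QPermAlg n K) :
    average h ρ p t ∈ W := by
  induction t using TensorProduct.induction_on with
  | zero => simp
  | add s t hs ht => rw [map_add]; exact W.add_mem hs ht
  | tmul v a =>
    rw [average_tmul]
    obtain ⟨s, hs⟩ := hW _ (hp v)
    rw [← hs]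
    clear hs
    induction s using TensorProduct.induction_on with
    | zero => simp
    | add s t hs ht =>
      rw [map_add, map_add, LinearMap.add_apply]
      exact W.add_mem hs ht
    | tmul w b => simpa using W.smul_mem _ w.2

/-- In Sweedler notation, `v₀ h(v₁ S(v₂)) = v₀ ε(v₁) h(1) = v`. -/
theorem IsHaar.average_id {h : QPermAlg n K →ₗ[K] K} (hh : IsHaar h) (v : V) :
    average h ρ LinearMap.id (ρ.coact v) = v := by
  have h1 : ∀ t : V ⊗[K] QPermAlg n K, average h ρ LinearMap.id t =
      TensorProduct.rid K V ((TensorProduct.lift (antipodePairing h)).lTensor V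
        (TensorProduct.assoc K V _ _ (ρ.coact.rTensor _ t))) := by
    intro t
    induction t using TensorProduct.induction_on with
    | zero => simp
    | add s t hs ht => simp only [map_add, hs, ht]
    | tmul v a =>
      simp only [average_tmul, LinearMap.id_apply, LinearMap.rTensor_tmul]
      generalize ρ.coact v = s
      induction s using TensorProduct.induction_on with
      | zero => simp
      | add s t hs ht => simp only [map_add, LinearMap.add_apply, TensorProduct.add_tmul, hs, ht]
      | tmul v c => simp
  have h2 : TensorProduct.lift (antipodePairing h) ∘ₗ (comulHom n K).toLinearMap =
      (counitHom n K).toLinearMap := by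
    have h3 : TensorProduct.lift (antipodePairing h) =
        h ∘ₗ LinearMap.mul' K _ ∘ₗ (antipodeLin n K).lTensor _ := by
      ext a b
      simp
    ext a
    simp [h3, antipode_right, Algebra.algebraMap_eq_smul_one, hh.one]
  rw [h1, coassoc_apply, ← LinearMap.lTensor_comp_apply, h2, counit_coact_apply]

theorem average_eq_of_mem_range (h : QPermAlg n K →ₗ[K] K) {p : V →ₗ[K] V} {W : Submodule K V}
    (hp : ∀ w ∈ W, p w = w) {t : V ⊗[K] QPermAlg n K}
    (ht : t ∈ LinearMap.range (W.subtype.rTensor (QPermAlg n K))) :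
    average h ρ p t = average h ρ LinearMap.id t := by
  obtain ⟨s, rfl⟩ := ht
  induction s using TensorProduct.induction_on with
  | zero => simp
  | add s t hs ht => simp only [map_add, hs, ht]
  | tmul w a => simp [hp w w.2]

/-- Over a field, tensoring with the algebra is exact, so the kernel of `q ⊗ id` is `ker q ⊗ H`. -/
theorem isSubcomodule_ker {q : V →ₗ[K] V}
    (hq : ∀ v, ρ.coact (q v) = q.rTensor _ (ρ.coact v)) : ρ.IsSubcomodule (LinearMap.ker q) := by
  intro v hv
  have : Function.Exact ((LinearMap.ker q).subtype.rTensor (QPermAlg n K))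
      (q.rTensor (QPermAlg n K)) := Module.Flat.rTensor_exact _ (LinearMap.exact_subtype_ker_map q)
  refine (this _).1 ?_
  rw [← hq, LinearMap.mem_ker.1 hv, map_zero]

theorem isSemisimple [CharZero K] : ρ.IsSemisimple := by
  intro W hW
  obtain ⟨h, hh⟩ := exists_isHaar n K
  obtain ⟨g, hg⟩ := W.subtype.exists_leftInverse_of_injective W.ker_subtype
  have hp : ∀ v, (W.subtype ∘ₗ g) v ∈ W := fun v => (g v).2
  have hpW : ∀ w ∈ W, (W.subtype ∘ₗ g) w = w := fun w hw =>
    congrArg Subtype.val (LinearMap.congr_fun hg ⟨w, hw⟩)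
  -- Averaging a linear projection onto `W` keeps its values in `W` and its identity action on `W`.
  let q : V →ₗ[K] V := average h ρ (W.subtype ∘ₗ g) ∘ₗ ρ.coact
  have hqW : ∀ v, q v ∈ W := fun v => average_mem ρ h hW hp _
  refine ⟨LinearMap.ker q, isSubcomodule_ker ρ (hh.coact_average ρ _), ?_⟩
  have := LinearMap.isCompl_of_proj (f := q.codRestrict W hqW) fun w => Subtype.ext <|
    (average_eq_of_mem_range ρ h hpW (hW w w.2)).trans (hh.average_id ρ w)
  rwa [LinearMap.ker_codRestrict] at this

end Average

/-! ### Intertwiners -/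

/-- A corepresentation embeds into a direct sum of tensorial ones. -/
theorem IsCorep.exists_intertwiners [CharZero K] {κ : Type} [Fintype κ] [DecidableEq κ]
    {x : Matrix κ κ (QPermAlg n K)} (hx : IsCorep x) :
    ∃ (σ : Type) (_ : Fintype σ) (ι : σ → Type) (_ : ∀ s, Fintype (ι s))
      (_ : ∀ s, DecidableEq (ι s)) (W : ∀ s, Matrix (ι s) (ι s) (QPermAlg n K))
      (T : ∀ s, Matrix (ι s) κ K),
      (∀ s, IsTensorial (W s)) ∧
      (∀ s, W s * (T s).map (algebraMap K (QPermAlg n K)) = (T s).map (algebraMap K _) * x) ∧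
      ∀ v : κ → K, (∀ s, (T s).mulVec v = 0) → v = 0 := by
  obtain ⟨h, hh⟩ := exists_isHaar n K
  choose ι hF hD W f hW hf using fun c : κ × κ => exists_isTensorial (x c.1 c.2)
  -- One intertwiner is taken for each entry `c` of `x` and each row `p` in the expansion of that
  -- entry in `W c`. It collects the terms of row `p`, with `h (· S(x))` applied to them.
  refine ⟨Σ c, ι c, inferInstance, fun s => ι s.1, fun s => hF s.1, fun s => hD s.1,
    fun s => W s.1, fun s => Matrix.of fun r m =>
      ∑ q, f s.1 s.2 q * h (W s.1 r q * antipodeLin n K (x s.1.2 m)), fun s => hW s.1, ?_, ?_⟩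
  · rintro ⟨c, p⟩
    refine Matrix.ext fun (a : ι c) m => ?_
    change ∑ r, W c a r * algebraMap K (QPermAlg n K)
        (∑ q, f c p q * h (W c r q * antipodeLin n K (x c.2 m))) =
      ∑ k, algebraMap K (QPermAlg n K)
        (∑ q, f c p q * h (W c a q * antipodeLin n K (x c.2 k))) * x k m
    simp only [← Algebra.commutes, ← Algebra.smul_def, Finset.sum_smul, mul_smul]
    rw [Finset.sum_comm, Finset.sum_comm (s := (Finset.univ : Finset κ))]
    refine Finset.sum_congr rfl fun q _ => ?_
    rw [← Finset.smul_sum, ← Finset.smul_sum]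
    congr 1
    exact hh.strong_invariant_corep (hW c).toIsCorep hx a q c.2 m
  · intro v hv
    -- The entries of `x` are recovered linearly from those of the intertwiners: strong invariance
    -- gives `∑ k, h (x i l * S (x l k)) • x k m`, and the sum over `l` collapses by `∑ l, x i l * S
    -- (x l k) = δ i k`.
    have key : ∀ i m, ∑ l, ∑ p, ∑ r, (∑ q, f (i, l) p q *
        h (W (i, l) r q * antipodeLin n K (x l m))) • W (i, l) p r = x i m := by
      intro i m
      have h1 : ∀ l, ∑ p, ∑ r, (∑ q, f (i, l) p q *
          h (W (i, l) r q * antipodeLin n K (x l m))) • W (i, l) p r =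
          ∑ k, h (x i l * antipodeLin n K (x l k)) • x k m := by
        intro l
        have h2 : ∀ k, h (x i l * antipodeLin n K (x l k)) =
            ∑ p, ∑ q, f (i, l) p q * h (W (i, l) p q * antipodeLin n K (x l k)) := by
          intro k
          conv_lhs => rw [hf (i, l)]
          simp only [Finset.sum_mul, smul_mul_assoc, map_sum, map_smul, smul_eq_mul]
        simp only [h2, Finset.sum_smul, mul_smul]
        rw [Finset.sum_comm (s := (Finset.univ : Finset κ))]
        refine Finset.sum_congr rfl fun p _ => ?_
        rw [Finset.sum_comm, Finset.sum_comm (s := (Finset.univ : Finset κ))]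
        refine Finset.sum_congr rfl fun q _ => ?_
        rw [← Finset.smul_sum, ← Finset.smul_sum]
        congr 1
        exact hh.strong_invariant_corep (hW (i, l)).toIsCorep hx p q l m
      simp only [h1]
      rw [Finset.sum_comm]
      simp only [← Finset.sum_smul, ← map_sum, hx.mul_antipode]
      simp [apply_ite h, hh.one]
    have hxv : ∀ i, ∑ m, v m • x i m = 0 := by
      intro i
      simp only [← key i, Finset.smul_sum]
      rw [Finset.sum_comm]
      refine Finset.sum_eq_zero fun l _ => ?_
      rw [Finset.sum_comm]
      refine Finset.sum_eq_zero fun p _ => ?_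
      rw [Finset.sum_comm]
      refine Finset.sum_eq_zero fun r _ => ?_
      simp only [smul_smul, ← Finset.sum_smul]
      have := congrFun (hv ⟨(i, l), p⟩) r
      simp only [Matrix.mulVec, dotProduct, Matrix.of_apply, Pi.zero_apply] at this
      simp only [mul_comm (v _), this, zero_smul]
    funext i
    -- The counit sends `x` to the identity matrix, so `x v = 0` forces `v = 0`.
    have := congrArg (counitHom n K) (hxv i)
    simpa [hx.counit] using this

/-! ### The complex star structure -/

theorem isMagic_op_u : IsMagic (fun i j : Fin n => MulOpposite.op (u i j : QPermAlg n K)) where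
  row_mul i j k := by
    rw [← MulOpposite.op_mul, row_mul]
    grind [MulOpposite.op_zero]
  row_sum i := by rw [← Finset.op_sum, row_sum, MulOpposite.op_one]
  col_mul i j k := by
    rw [← MulOpposite.op_mul, col_mul]
    grind [MulOpposite.op_zero]
  col_sum i := by rw [← Finset.op_sum, col_sum, MulOpposite.op_one]

variable (n) in
/-- The involution as a ring homomorphism to the opposite ring. -/
def starHom : QPermAlg n ℂ →+* (QPermAlg n ℂ)ᵐᵒᵖ :=
  -- Twisting the scalars by conjugation makes the lifted algebra map conjugate-linear.
  letI : Algebra ℂ (QPermAlg n ℂ)ᵐᵒᵖ := Algebra.compHom _ (starRingEnd ℂ)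
  (lift (K := ℂ) _ (isMagic_op_u (n := n) (K := ℂ))).toRingHom

@[simp]
theorem starHom_u (i j : Fin n) : starHom n (u i j) = MulOpposite.op (u i j) := by
  let : Algebra ℂ (QPermAlg n ℂ)ᵐᵒᵖ := Algebra.compHom _ (starRingEnd ℂ)
  exact lift_u (K := ℂ) _ (isMagic_op_u (n := n) (K := ℂ)) i j

@[simp]
theorem starHom_algebraMap (c : ℂ) :
    starHom n (algebraMap ℂ _ c) = MulOpposite.op (algebraMap ℂ _ (star c)) := by
  let : Algebra ℂ (QPermAlg n ℂ)ᵐᵒᵖ := Algebra.compHom _ (starRingEnd ℂ)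
  exact AlgHom.commutes (lift (K := ℂ) _ (isMagic_op_u (n := n) (K := ℂ))) c

theorem unop_starHom_unop_starHom (a : QPermAlg n ℂ) :
    (starHom n (starHom n a).unop).unop = a := by
  induction a using induction with
  | hK r => simp
  | hu i j => simp
  | hmul a b ha hb => simp [ha, hb]
  | hadd a b ha hb => simp [ha, hb]

instance : StarRing (QPermAlg n ℂ) where
  star a := (starHom n a).unop
  star_involutive := unop_starHom_unop_starHom
  star_mul a b := by simp
  star_add a b := by simp

theorem star_def (a : QPermAlg n ℂ) : star a = (starHom n a).unop := rfl

@[simp]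
theorem star_u (i j : Fin n) : star (u i j : QPermAlg n ℂ) = u i j := by simp [star_def]

instance : StarModule ℂ (QPermAlg n ℂ) where
  star_smul c a := by
    rw [Algebra.smul_def, star_mul, star_def (algebraMap _ _ _), starHom_algebraMap,
      MulOpposite.unop_op, ← Algebra.commutes, ← Algebra.smul_def]

theorem star_algebraMap (c : ℂ) :
    star (algebraMap ℂ (QPermAlg n ℂ) c) = algebraMap ℂ _ (star c) := by
  rw [star_def, starHom_algebraMap, MulOpposite.unop_op]

theorem comulHom_star (a : QPermAlg n ℂ) : comulHom n ℂ (star a) = star (comulHom n ℂ a) := by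
  induction a using induction with
  | hK r =>
    rw [star_algebraMap, AlgHom.commutes, AlgHom.commutes, Algebra.algebraMap_eq_smul_one,
      Algebra.algebraMap_eq_smul_one, star_smul, star_one]
  | hu i j => simp
  | hmul a b ha hb => rw [star_mul, map_mul, ha, hb, map_mul, star_mul]
  | hadd a b ha hb => rw [star_add, map_add, ha, hb, map_add, star_add]

theorem counitHom_star (a : QPermAlg n ℂ) : counitHom n ℂ (star a) = star (counitHom n ℂ a) := by
  induction a using induction with
  | hK r =>
    rw [star_algebraMap, AlgHom.commutes, AlgHom.commutes]
    rfl
  | hu i j =>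
    rw [star_u, counitHom_u]
    split_ifs <;> simp
  | hmul a b ha hb => rw [star_mul, map_mul, ha, hb, map_mul, star_mul]
  | hadd a b ha hb => rw [star_add, map_add, ha, hb, map_add, star_add]

/-! ### Unitarizability of finite-dimensional complex comodules -/

open Matrix

/-- Star and antipode both reverse products, and `S(u i j) = u j i` is self-adjoint. Hence `X*` is
the antipode matrix of `X`. -/
theorem IsTensorial.star_apply {ι : Type*} [Fintype ι] [DecidableEq ι]
    {X : Matrix ι ι (QPermAlg n ℂ)} (hX : IsTensorial X) (i j : ι) :
    star (X j i) = antipodeLin n ℂ (X i j) := by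
  have h : ∀ p ∈ swapRel n ℂ, star p.2 = antipodeLin n ℂ p.1 := by
    intro p hp
    induction hp using Submonoid.closure_induction with
    | mem p hp =>
      rcases hp with rfl | ⟨q, rfl⟩
      · simp
      · simp
    | one =>
      have := antipodeLin_algebraMap (n := n) (K := ℂ) 1
      simpa using this.symm
    | mul p q _ _ hp hq => simp [hp, hq, antipodeLin_mul]
  exact h _ (hX.swap i j)

theorem IsTensorial.conjTranspose_mul_self {ι : Type*} [Fintype ι] [DecidableEq ι]
    {X : Matrix ι ι (QPermAlg n ℂ)} (hX : IsTensorial X) : Xᴴ * X = 1 := by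
  ext i j
  simp only [Matrix.mul_apply, Matrix.conjTranspose_apply, hX.star_apply, hX.antipode_mul,
    Matrix.one_apply]

open scoped MatrixOrder ComplexOrder in
theorem IsCorep.exists_unitary_conj {κ : Type} [Fintype κ] [DecidableEq κ]
    {x : Matrix κ κ (QPermAlg n ℂ)} (hx : IsCorep x) :
    ∃ R : Matrix κ κ ℂ, IsUnit R.det ∧
      R.map (algebraMap ℂ (QPermAlg n ℂ)) * x * R⁻¹.map (algebraMap ℂ (QPermAlg n ℂ)) ∈
        unitary (Matrix κ κ (QPermAlg n ℂ)) := by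
  obtain ⟨σ, _, ι, _, _, W, T, hW, hT, hinj⟩ := hx.exists_intertwiners
  let G : Matrix κ κ ℂ := ∑ s, (T s)ᴴ * T s
  have hG : 0 ≤ G := (posSemidef_sum _ fun s _ => posSemidef_conjTranspose_mul_self (T s)).nonneg
  obtain ⟨R, hR⟩ := CStarAlgebra.nonneg_iff_eq_star_mul_self.mp hG
  rw [star_eq_conjTranspose] at hR
  -- Here `v* G v` is the sum of the squared norms of the `T s *ᵥ v`, so joint injectivity makes
  -- `G`, hence `R`, invertible.
  have hker : ∀ v, G *ᵥ v = 0 → v = 0 := by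
    intro v hv
    refine hinj v fun s => ?_
    have h0 : ∑ s, star (T s *ᵥ v) ⬝ᵥ (T s *ᵥ v) = 0 := by
      have : star v ⬝ᵥ (G *ᵥ v) = 0 := by rw [hv, dotProduct_zero]
      rw [← this]
      simp only [G, sum_mulVec, dotProduct_sum, ← mulVec_mulVec, star_mulVec,
        ← dotProduct_mulVec]
    have := (Finset.sum_eq_zero_iff_of_nonneg fun s _ => dotProduct_star_self_nonneg _).1 h0 s
      (Finset.mem_univ s)
    exact dotProduct_star_self_eq_zero.1 this
  have hdet : IsUnit R.det := by
    rw [isUnit_iff_ne_zero]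
    intro h
    obtain ⟨v, hv, hRv⟩ := exists_mulVec_eq_zero_iff.2 h
    refine hv (hker v ?_)
    rw [hR, ← mulVec_mulVec, hRv, mulVec_zero]
  refine ⟨R, hdet, ?_⟩
  let A := algebraMap ℂ (QPermAlg n ℂ)
  have hmul : ∀ {l m o : Type} [Fintype m] (M : Matrix l m ℂ) (N : Matrix m o ℂ),
      (M * N).map A = M.map A * N.map A := fun M N => Matrix.map_mul
  have hstar : ∀ {l m : Type} (M : Matrix l m ℂ), (M.map A)ᴴ = Mᴴ.map A := by
    intro l m M
    ext i j
    exact star_algebraMap _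
  have hT' : ∀ s, W s * (T s).map A = (T s).map A * x := hT
  -- Each `T s` intertwines `x` with `W s`, and `(W s)ᴴ * W s = 1`.
  have hinv : xᴴ * G.map A * x = G.map A := by
    have h1 : ∀ s, xᴴ * ((T s)ᴴ * T s).map A * x = ((T s)ᴴ * T s).map A := by
      intro s
      calc xᴴ * ((T s)ᴴ * T s).map A * x = ((T s).map A * x)ᴴ * ((T s).map A * x) := by
            simp only [hmul, conjTranspose_mul, hstar, Matrix.mul_assoc]
        _ = ((T s).map A)ᴴ * ((W s)ᴴ * W s) * (T s).map A := by
            rw [← hT' s, conjTranspose_mul]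
            simp only [Matrix.mul_assoc]
        _ = _ := by rw [(hW s).conjTranspose_mul_self, Matrix.mul_one, hstar, ← hmul]
    have h2 : G.map A = ∑ s, ((T s)ᴴ * T s).map A := map_sum A.mapMatrix _ _
    rw [h2, Matrix.mul_sum, Matrix.sum_mul]
    exact Finset.sum_congr rfl fun s _ => h1 s
  have hone : (1 : Matrix κ κ ℂ).map A = 1 := map_one A.mapMatrix
  have hRR : R.map A * R⁻¹.map A = 1 := by rw [← hmul, mul_nonsing_inv _ hdet, hone]
  have hRR' : R⁻¹.map A * R.map A = 1 := by rw [← hmul, nonsing_inv_mul _ hdet, hone]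
  set y := R.map A * x * R⁻¹.map A with hy
  have hyy : yᴴ * y = 1 := by
    calc yᴴ * y = (R⁻¹.map A)ᴴ * (xᴴ * ((R.map A)ᴴ * R.map A) * x) * R⁻¹.map A := by
          simp only [hy, conjTranspose_mul, Matrix.mul_assoc]
      _ = (R.map A * R⁻¹.map A)ᴴ * (R.map A * R⁻¹.map A) := by
          rw [hstar R, ← hmul, ← hR, hinv, hR, hmul, ← hstar R]
          simp only [conjTranspose_mul, Matrix.mul_assoc]
      _ = 1 := by rw [hRR, conjTranspose_one, Matrix.mul_one]
  have hxS : x * x.map (antipodeLin n ℂ) = 1 := by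
    ext i j
    simp only [Matrix.mul_apply, Matrix.map_apply, hx.mul_antipode, Matrix.one_apply]
  -- The entries do not commute, so `yᴴ * y = 1` alone does not give `y * yᴴ = 1`; the antipode
  -- supplies a right inverse, which must then equal `yᴴ`.
  have hyr : y * (R.map A * x.map (antipodeLin n ℂ) * R⁻¹.map A) = 1 := by
    calc y * (R.map A * x.map (antipodeLin n ℂ) * R⁻¹.map A)
        = R.map A * (x * (R⁻¹.map A * R.map A) * x.map (antipodeLin n ℂ)) * R⁻¹.map A := by
          simp only [hy, Matrix.mul_assoc]
      _ = 1 := by rw [hRR', Matrix.mul_one, hxS, Matrix.mul_one, hRR]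
  rw [Unitary.mem_iff]
  refine ⟨hyy, ?_⟩
  change y * yᴴ = 1
  rw [left_inv_eq_right_inv hyy hyr]
  exact hyr

theorem exists_isCorep {V : Type w} [AddCommGroup V] [Module K V] {κ : Type*}
    [Fintype κ] [DecidableEq κ]
    (ρ : RightComodule K (QPermAlg n K) V) (b : Module.Basis κ K V) :
    ∃ x : Matrix κ κ (QPermAlg n K), IsCorep x ∧ ∀ j, ρ.coact (b j) = ∑ i, b i ⊗ₜ x i j := by
  let x : Matrix κ κ (QPermAlg n K) := Matrix.of fun i j =>
    TensorProduct.lid K _ ((b.coord i).rTensor _ (ρ.coact (b j)))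
  have hx : ∀ j, ρ.coact (b j) = ∑ i, b i ⊗ₜ x i j := by
    intro j
    simp only [x, Matrix.of_apply]
    generalize ρ.coact (b j) = t
    induction t using TensorProduct.induction_on with
    | zero => simp
    | add s t hs ht =>
      simp only [map_add, TensorProduct.tmul_add, Finset.sum_add_distrib, ← hs, ← ht]
    | tmul v a =>
      simp only [LinearMap.rTensor_tmul, TensorProduct.lid_tmul, ← TensorProduct.smul_tmul,
        ← TensorProduct.sum_tmul, Module.Basis.coord_apply, b.sum_repr]
  refine ⟨x, ⟨fun i j => ?_, fun i j => ?_⟩, hx⟩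
  · have := coassoc_apply ρ (b j)
    simp only [hx, map_sum, LinearMap.rTensor_tmul, LinearMap.lTensor_tmul,
      TensorProduct.sum_tmul, TensorProduct.assoc_tmul, AlgHom.toLinearMap_apply] at this
    have := congrArg (fun t => TensorProduct.lid K _ ((b.coord i).rTensor _ t)) this
    simpa [Finsupp.single_apply, ite_smul, Finset.sum_ite_eq] using this.symm
  · have := congrArg (b.coord i) (counit_coact_apply ρ (b j))
    simp only [hx, map_sum, LinearMap.lTensor_tmul, TensorProduct.rid_tmul] at this
    simpa [Finsupp.single_apply, eq_comm] using this

theorem isUnitarizable {V : Type w} [AddCommGroup V] [Module ℂ V] [FiniteDimensional ℂ V]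
    (ρ : RightComodule ℂ (QPermAlg n ℂ) V) : ρ.IsUnitarizable := by
  let b := Module.finBasis ℂ V
  obtain ⟨x, hx, hρ⟩ := exists_isCorep ρ b
  obtain ⟨R, hR, hU⟩ := hx.exists_unitary_conj
  let A := algebraMap ℂ (QPermAlg n ℂ)
  -- In the basis with coordinate columns those of `R⁻¹`, the coaction matrix is `R x R⁻¹`.
  let e := Matrix.toLinearEquiv b R⁻¹ ((isUnit_nonsing_inv_det_iff).2 hR)
  have he : ∀ j, b.map e j = ∑ i, R⁻¹ i j • b i := fun j => Matrix.toLin_self b b R⁻¹ j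
  have he' : ∀ k, b k = ∑ l, R l k • b.map e l := by
    intro k
    simp only [he, Finset.smul_sum, smul_smul]
    rw [Finset.sum_comm]
    simp only [← Finset.sum_smul, mul_comm (R _ _), ← Matrix.mul_apply]
    rw [nonsing_inv_mul _ hR]
    simp [Matrix.one_apply]
  refine ⟨_, b.map e, R.map A * x * R⁻¹.map A, fun j => ?_, hU⟩
  calc ρ.coact (b.map e j) = ∑ m, R⁻¹ m j • ∑ k, b k ⊗ₜ x k m := by
        rw [he]
        simp only [map_sum, map_smul, hρ]
    _ = ∑ m, R⁻¹ m j • ∑ k, ∑ l, (R l k • b.map e l) ⊗ₜ x k m := by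
        simp only [← TensorProduct.sum_tmul, ← he']
    _ = ∑ l, b.map e l ⊗ₜ ∑ m, R⁻¹ m j • ∑ k, R l k • x k m := by
        simp only [Finset.smul_sum, TensorProduct.tmul_sum, TensorProduct.tmul_smul,
          ← TensorProduct.smul_tmul']
        conv_rhs => rw [Finset.sum_comm]
        refine Finset.sum_congr rfl fun m _ => ?_
        exact Finset.sum_comm
    _ = _ := by
        simp only [Matrix.mul_apply, Matrix.map_apply, A, ← Algebra.commutes,
          ← Algebra.smul_def]

end

end QPermAlg

theorem proposition3p5 (n : ℕ) :
    (∀ (K : Type u) [Field K] [CharZero K], IsCosemisimple.{u, u, w} K (QPermAlg n K)) ∧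
    (∃ (_ : StarRing (QPermAlg n ℂ)) (_ : StarModule ℂ (QPermAlg n ℂ)),
      (∀ i j : Fin n, star (QPermAlg.u i j : QPermAlg n ℂ) = QPermAlg.u i j) ∧
      IsCQGAlgebra.{0, w} (QPermAlg n ℂ)) :=
  ⟨fun _ _ _ _ _ _ ρ => QPermAlg.isSemisimple ρ, inferInstance, inferInstance, QPermAlg.star_u,
    { comul_star := QPermAlg.comulHom_star
      counit_star := QPermAlg.counitHom_star
      unitarizable := fun _ _ _ _ ρ => QPermAlg.isUnitarizable ρ }⟩
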